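/- A re-pairing of a well-formed (Dyck) word $\sigma=\sigma(1)\cdots\sigma(N)$ over the brackets $+$ (opening) and $-$ (closing) is a sequence of pairs $p=((\ell_1,r_1),\dots,(\ell_{N/2},r_{N/2}))$ of positions such that $\sigma(\ell_i)=+$, $\sigma(r_i)=-$ and $\ell_i<r_i$ for all $i$, and every position in $\{1,\dots,N\}$ occurs in exactly one pair. Let $B_t(p)$ be the set of positions occurring in the first $t$ pairs. The width of a finite set of integers is the smallest number of integer intervals whose union is that set; the width of $p$ is the maximum over $0\le t\le N/2$ of the width of $B_t(p)$; and $\operatorname{width}(\sigma)$ is the minimum of the widths of the re-pairings of $\sigma$. Let $Z(n)$, $n\ge 1$, be the words associated with the complete binary trees of height $n-1$, that is, $Z(1)={+}{-}$ and $Z(n+1)={+}Z(n)Z(n){-}$, and let $|Z(n)|$ be the length of $Z(n)$. Then, as $n\to\infty$, $$\operatorname{width}(Z(n))=\Omega\!\left(\frac{\log n}{\log\log n}\right)\quad\text{and}\quad \operatorname{width}(Z(n))=\Omega\!\left(\frac{\log\log|Z(n)|}{\log\log\log|Z(n)|}\right),$$ and these two bounds are of the same order: $$\frac{\log n}{\log\log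 n}=\Theta\!\left(\frac{\log\log|Z(n)|}{\log\log\log|Z(n)|}\right).$$ -/

import Mathlib

open Filter Asymptotics

/-! Re-pairings of Dyck words and their width. Dyck words are Mathlib's `DyckWord`: lists of
`DyckStep.U` (an opening bracket, `+`) and `DyckStep.D` (a closing bracket, `-`). -/

namespace RePairing

/-- The smallest number of integer intervals `[a, b]` whose union is the finite set `S`. -/
noncomputable def intervalWidth (S : Finset ℤ) : ℕ :=
  sInf {k : ℕ | ∃ a b : Fin k → ℤ, (S : Set ℤ) = ⋃ i, Set.Icc (a i) (b i)}

/-- A re-pairing of a Dyck word `w` of length `N`: a sequence of `N / 2` pairs of positions such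
that each pair consists of an opening bracket and a closing bracket to its right, and every
position of `w` occurs in exactly one pair. Positions are counted from `0`. -/
structure Repairing (w : DyckWord) where
  left : Fin (w.toList.length / 2) → Fin w.toList.length
  right : Fin (w.toList.length / 2) → Fin w.toList.length
  left_open : ∀ i, w.toList.get (left i) = DyckStep.U
  right_close : ∀ i, w.toList.get (right i) = DyckStep.D
  left_lt_right : ∀ i, left i < right i
  exactly_one : ∀ b, ∃! i, b = left i ∨ b = right i

/-- The set of positions erased by the first `t` pairs. -/
def Repairing.erased {w : DyckWord} (p : Repairing w) (t : ℕ) : Finset ℤ :=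
  (Finset.univ.filter fun i : Fin (w.toList.length / 2) => (i : ℕ) < t).biUnion
    fun i => {((p.left i : ℕ) : ℤ), ((p.right i : ℕ) : ℤ)}

/-- The width of a re-pairing: the maximum over the times `t = 0, 1, …, N / 2` of the width of
the set of positions erased up to time `t`. -/
noncomputable def Repairing.width {w : DyckWord} (p : Repairing w) : ℕ :=
  (Finset.range (w.toList.length / 2 + 1)).sup fun t => intervalWidth (p.erased t)

/-- The width of a Dyck word: the minimum width of a re-pairing of it. -/
noncomputable def width (w : DyckWord) : ℕ :=
  sInf (Set.range fun p : Repairing w => p.width)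

/-- The word `Z(n)` of the complete binary tree of height `n - 1`: `Z(1) = +-` and
`Z(n+1) = + Z(n) Z(n) -`. The value at `0` is the empty word, so that one recursion covers both
clauses. -/
def Z : ℕ → DyckWord
  | 0 => 0
  | n + 1 => (Z n + Z n).nest

theorem Z_one : (Z 1).toList = [DyckStep.U, DyckStep.D] := rfl

theorem Z_succ (n : ℕ) :
    (Z (n + 1)).toList = [DyckStep.U] ++ ((Z n).toList ++ (Z n).toList) ++ [DyckStep.D] := rfl

end RePairing

/-!
Stack a word as a mountain whose height counts the unmatched opening brackets. Erasing a pair adds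
a nonnegative height to the erased part at every position, so the height of the erased part only
grows with time and stays between `0` and the height of the mountain. Membership in a set of width
`k` switches at most `2k` times along the word, hence the erased part changes little in height
across a copy of `Z(m)`, by at most `(2k + 1)m`.

Suppose that every copy of `Z(m)` has at some time more than `j` switches inside it. A copy of
`Z((2k + 4)m)` contains `2^m` disjoint copies of `Z(m)`, each at the top of an ascent of height
`(2k + 2)m` that begins to the right of the previous ones. If the large copy never had more than
`j + 1` switches, then at the time of a small copy all of them would be inside that small copy.
Moving on from one small copy to the next one, say later in time, the whole ascent in front of the
new one is erased while nothing to the right of it is, so the height of the erased part at the right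
end has grown by at least one; if the times run backwards, argue with the part not yet erased. After
`2^m` small copies this exceeds the height of the mountain, unless `2^m` is smaller than about that
height. So one more switch costs only a factor `2k + 4` in the height of the tree: starting at `m`
about `√n`, a tree of height `n ≥ (2k + 4)^(2k) m` would force more than `2k` switches, and hence
`n < (2k + 4)^(4k)` for the width `k` of `Z(n)`.
-/

namespace RePairing

section Walk

/-- The height reached after the first `n` increments of the walk `x`. The height of
`S.indicator x` takes only the increments at the positions in `S` into account. -/
def height (x : ℕ → ℤ) (n : ℕ) : ℤ := ∑ i ∈ Finset.range n, x i

open Classical in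
/-- The positions `p` with `a ≤ p < b` such that exactly one of `p` and `p + 1` lies in `S`. -/
noncomputable def switches (S : Set ℕ) (a b : ℕ) : Finset ℕ :=
  (Finset.Ico a b).filter fun p => ¬(p ∈ S ↔ p + 1 ∈ S)

theorem mem_switches {S : Set ℕ} {a b p : ℕ} :
    p ∈ switches S a b ↔ (a ≤ p ∧ p < b) ∧ ¬(p ∈ S ↔ p + 1 ∈ S) := by
  simp [switches]

theorem switches_subset {S : Set ℕ} {a b c d : ℕ} (hac : a ≤ c) (hdb : d ≤ b) :
    switches S c d ⊆ switches S a b := by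
  classical exact Finset.filter_subset_filter _ (Finset.Ico_subset_Ico hac hdb)

theorem mem_iff_mem_of_forall_notMem_switches {S : Set ℕ} {a b c d : ℕ} (hac : a ≤ c)
    (hcd : c ≤ d) (hdb : d ≤ b) (h : ∀ q ∈ Set.Ico c d, q ∉ switches S a b) :
    c ∈ S ↔ d ∈ S := by
  induction d, hcd using Nat.le_induction with
  | base => rfl
  | succ d hcd ih =>
    rw [ih (by omega) fun q hq => h q ⟨hq.1, hq.2.trans d.lt_succ_self⟩]
    by_contra hd
    exact h d ⟨hcd, d.lt_succ_self⟩ (mem_switches.2 ⟨⟨by omega, by omega⟩, hd⟩)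

theorem exists_mem_and_exists_notMem_of_switches_nonempty {S : Set ℕ} {a b : ℕ}
    (h : (switches S a b).Nonempty) :
    (∃ q ∈ Set.Icc a b, q ∈ S) ∧ ∃ q ∈ Set.Icc a b, q ∉ S := by
  obtain ⟨p, hp⟩ := h
  obtain ⟨⟨hap, hpb⟩, hswitch⟩ := mem_switches.1 hp
  have hp : p ∈ Set.Icc a b := ⟨hap, hpb.le⟩
  have hp' : p + 1 ∈ Set.Icc a b := ⟨by omega, hpb⟩
  by_cases hpS : p ∈ S
  · exact ⟨⟨p, hp, hpS⟩, p + 1, hp', fun h => hswitch (iff_of_true hpS h)⟩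
  · exact ⟨⟨p + 1, hp', by_contra fun h => hswitch (iff_of_false hpS h)⟩, p, hp, hpS⟩

variable {x : ℕ → ℤ} {S : Set ℕ} {a b : ℕ}

theorem height_succ (x : ℕ → ℤ) (n : ℕ) : height x (n + 1) = height x n + x n :=
  Finset.sum_range_succ x n

theorem height_sub_height (x : ℕ → ℤ) (hab : a ≤ b) :
    height x b - height x a = ∑ i ∈ Finset.Ico a b, x i :=
  (Finset.sum_Ico_eq_sub x hab).symm

theorem height_indicator_compl (x : ℕ → ℤ) (S : Set ℕ) (n : ℕ) :
    height (Sᶜ.indicator x) n = height x n - height (S.indicator x) n := by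
  simp only [height, Set.indicator_compl, Pi.sub_apply, Finset.sum_sub_distrib]

theorem height_indicator_union (x : ℕ → ℤ) {S T : Set ℕ} (h : Disjoint S T) (n : ℕ) :
    height ((S ∪ T).indicator x) n = height (S.indicator x) n + height (T.indicator x) n := by
  simp only [height, Set.indicator_union_of_disjoint h, Finset.sum_add_distrib]

theorem height_indicator_singleton (x : ℕ → ℤ) (p n : ℕ) :
    height (({p} : Set ℕ).indicator x) n = if p < n then x p else 0 := by
  simp [height, Set.indicator_apply, Finset.sum_ite_eq']

theorem height_indicator_sub_of_forall_mem (hab : a ≤ b) (h : ∀ q ∈ Set.Ico a b, q ∈ S) :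
    height (S.indicator x) b - height (S.indicator x) a = height x b - height x a := by
  rw [height_sub_height _ hab, height_sub_height _ hab]
  exact Finset.sum_congr rfl fun q hq => Set.indicator_of_mem (h q (Finset.mem_Ico.1 hq)) x

theorem height_indicator_eq_of_forall_notMem (hab : a ≤ b) (h : ∀ q ∈ Set.Ico a b, q ∉ S) :
    height (S.indicator x) b = height (S.indicator x) a := by
  rw [← sub_eq_zero, height_sub_height _ hab]
  exact Finset.sum_eq_zero fun q hq => Set.indicator_of_notMem (h q (Finset.mem_Ico.1 hq)) x

/- Summation by parts: the left-hand side is the sum of `height x (p + 1) - E` over the switches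
`p`, with signs. -/
theorem abs_height_indicator_sub_sub_le {E m : ℤ} (hab : a ≤ b)
    (hx : ∀ q ∈ Set.Icc a b, height x q ∈ Set.Icc E (E + m)) :
    |height (S.indicator x) b - height (S.indicator x) a -
      (S.indicator (fun q => height x q - E) b - S.indicator (fun q => height x q - E) a)| ≤
        (switches S a b).card * m := by
  classical
  induction b, hab using Nat.le_induction with
  | base => simp [switches]
  | succ b hab ih =>
    specialize ih fun q hq => hx q ⟨hq.1, hq.2.trans b.le_succ⟩
    obtain ⟨hE, hm⟩ := hx (b + 1) ⟨by omega, le_rfl⟩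
    have hcard : (switches S a (b + 1)).card =
        (switches S a b).card + if b ∈ S ↔ b + 1 ∈ S then 0 else 1 := by
      simp only [switches, Finset.card_filter, Finset.sum_Ico_succ_top hab, ite_not]
    have hstep : |S.indicator x b - (S.indicator (fun q => height x q - E) (b + 1) -
        S.indicator (fun q => height x q - E) b)| ≤ (if b ∈ S ↔ b + 1 ∈ S then 0 else 1) * m := by
      rw [height_succ] at hE hm
      by_cases hb : b ∈ S <;> by_cases hb' : b + 1 ∈ S <;>
        simp only [hb, hb', height_succ, abs_le, Set.indicator_of_mem, Set.indicator_of_notMem,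
          not_false_eq_true, reduceIte, iff_true, iff_false, not_true, zero_mul, one_mul] <;>
        constructor <;> linarith
    rw [height_succ (S.indicator x), hcard]
    push_cast
    rw [abs_le] at ih hstep ⊢
    constructor <;> linarith

theorem abs_height_indicator_sub_le {E m : ℤ} (hab : a ≤ b)
    (hx : ∀ q ∈ Set.Icc a b, height x q ∈ Set.Icc E (E + m)) :
    |height (S.indicator x) b - height (S.indicator x) a| ≤ ((switches S a b).card + 1) * m := by
  have hend : ∀ q ∈ Set.Icc a b, S.indicator (fun q => height x q - E) q ∈ Set.Icc 0 m := by
    intro q hq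
    obtain ⟨hE, hm⟩ := hx q hq
    by_cases hqS : q ∈ S <;> simp only [hqS, Set.indicator_of_mem, Set.indicator_of_notMem,
      not_false_eq_true] <;> constructor <;> linarith
  have hsum := abs_le.1 (abs_height_indicator_sub_sub_le (S := S) hab hx)
  obtain ⟨ha, ha'⟩ := hend a ⟨le_rfl, hab⟩
  obtain ⟨hb, hb'⟩ := hend b ⟨hab, le_rfl⟩
  rw [abs_le]
  constructor <;> linarith [hsum.1, hsum.2]

end Walk

section Sweep

/-- The switches of `S` between `a` and `b` all lie between `c` and `d`, and there is at least one
of them. -/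
structure SplitsWithin (S : Set ℕ) (a b c d : ℕ) : Prop where
  le_left : a ≤ c
  right_le : d ≤ b
  mem_left_iff : ∀ q ∈ Set.Icc a c, q ∈ S ↔ a ∈ S
  mem_right_iff : ∀ q ∈ Set.Icc d b, q ∈ S ↔ b ∈ S
  exists_mem : ∃ q ∈ Set.Icc c d, q ∈ S
  exists_notMem : ∃ q ∈ Set.Icc c d, q ∉ S

theorem splitsWithin_of_card_switches_le {S : Set ℕ} {a b c d : ℕ} (hac : a ≤ c) (hdb : d ≤ b)
    (hpos : (switches S c d).Nonempty)
    (hle : (switches S a b).card ≤ (switches S c d).card) : SplitsWithin S a b c d := by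
  have heq : switches S c d = switches S a b :=
    Finset.eq_of_subset_of_card_le (switches_subset hac hdb) hle
  have hout : ∀ q, q < c ∨ d ≤ q → q ∉ switches S a b := fun q hq hmem => by
    rw [← heq, mem_switches] at hmem
    omega
  have hmem := exists_mem_and_exists_notMem_of_switches_nonempty hpos
  have hcd : c ≤ d := hmem.1.elim fun q hq => hq.1.1.trans hq.1.2
  refine ⟨hac, hdb, fun q hq => ?_, fun q hq => ?_, hmem.1, hmem.2⟩
  · exact (mem_iff_mem_of_forall_notMem_switches le_rfl hq.1 (by grind) fun r hr =>
      hout r (Or.inl (hr.2.trans_le hq.2))).symm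
  · exact mem_iff_mem_of_forall_notMem_switches (by grind) hq.2 le_rfl fun r hr =>
      hout r (Or.inr (hq.1.trans hr.1))

namespace SplitsWithin

variable {S S' : Set ℕ} {a b c d c' d' : ℕ}

theorem left_le_right (h : SplitsWithin S a b c d) : c ≤ d :=
  h.exists_mem.elim fun _ hq => hq.1.1.trans hq.1.2

theorem compl (h : SplitsWithin S a b c d) : SplitsWithin Sᶜ a b c d where
  le_left := h.le_left
  right_le := h.right_le
  mem_left_iff q hq := not_congr (h.mem_left_iff q hq)
  mem_right_iff q hq := not_congr (h.mem_right_iff q hq)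
  exists_mem := h.exists_notMem
  exists_notMem := h.exists_mem.imp fun _ hq => ⟨hq.1, not_not.2 hq.2⟩

theorem left_mem_of_subset (h : SplitsWithin S a b c d) (h' : SplitsWithin S' a b c' d')
    (hdc : d ≤ c') (hS : S ⊆ S') : a ∈ S' := by
  obtain ⟨q, hq, hqS⟩ := h.exists_mem
  exact (h'.mem_left_iff q ⟨h.le_left.trans hq.1, hq.2.trans hdc⟩).1 (hS hqS)

theorem right_notMem_of_subset (h : SplitsWithin S a b c d) (h' : SplitsWithin S' a b c' d')
    (hdc : d ≤ c') (hS : S ⊆ S') : b ∉ S := by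
  obtain ⟨q, hq, hqS'⟩ := h'.exists_notMem
  exact fun hb => hqS' (hS ((h.mem_right_iff q ⟨hdc.trans hq.1, hq.2.trans h'.right_le⟩).2 hb))

theorem left_notMem_of_subset (h : SplitsWithin S a b c d) (h' : SplitsWithin S' a b c' d')
    (hdc : d ≤ c') (hS : S' ⊆ S) : a ∉ S' :=
  h.compl.left_mem_of_subset h'.compl hdc (Set.compl_subset_compl.2 hS)

theorem right_mem_of_subset (h : SplitsWithin S a b c d) (h' : SplitsWithin S' a b c' d')
    (hdc : d ≤ c') (hS : S' ⊆ S) : b ∈ S :=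
  not_not.1 (h.compl.right_notMem_of_subset h'.compl hdc (Set.compl_subset_compl.2 hS))

end SplitsWithin

/-- `S t` is the set of positions erased up to time `t` when the walk `x` is erased by moves that
have nonnegative height: every `height ((S t).indicator x) n` grows with `t`, within the range from
`0` (nothing erased) to `height x n` (everything erased). -/
structure IsErasure {ι : Type*} [Preorder ι] (x : ℕ → ℤ) (S : ι → Set ℕ) : Prop where
  monotone : Monotone S
  monotone_height : ∀ n, Monotone fun t => height ((S t).indicator x) n
  height_nonneg : ∀ t n, 0 ≤ height ((S t).indicator x) n
  height_le : ∀ t n, height ((S t).indicator x) n ≤ height x n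

namespace IsErasure

theorem dual {ι : Type*} [Preorder ι] {x : ℕ → ℤ} {S : ι → Set ℕ} (hS : IsErasure x S) :
    IsErasure x fun t : ιᵒᵈ => (S (OrderDual.ofDual t))ᶜ where
  monotone _ _ hst := Set.compl_subset_compl.2 (hS.monotone hst)
  monotone_height n s t hst := by
    simp only [height_indicator_compl]
    exact sub_le_sub_left (hS.monotone_height n hst) _
  height_nonneg t n := by
    rw [height_indicator_compl]
    exact sub_nonneg.2 (hS.height_le _ n)
  height_le t n := by
    rw [height_indicator_compl]
    exact sub_le_self _ (hS.height_nonneg _ n)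

theorem height_lt_of_splitsWithin {ι : Type*} [Preorder ι] {x : ℕ → ℤ} {S : ι → Set ℕ}
    (hS : IsErasure x S) {s t : ι} {a b c d p c' d' : ℕ}
    (hst : s ≤ t) (h : SplitsWithin (S s) a b c d) (h' : SplitsWithin (S t) a b c' d')
    (hdp : d ≤ p) (hpc : p ≤ c') (hb : b ∉ S t)
    (hclimb : height ((S t).indicator x) c' - height ((S t).indicator x) d' <
      height x c' - height x p) :
    height ((S s).indicator x) b < height ((S t).indicator x) b := by
  have ha : a ∈ S t := h.left_mem_of_subset h' (hdp.trans hpc) (hS.monotone hst)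
  have hb' : b ∉ S s := h.right_notMem_of_subset h' (hdp.trans hpc) (hS.monotone hst)
  have hpb : p ≤ b := hpc.trans (h'.left_le_right.trans h'.right_le)
  have hap : a ≤ p := h.le_left.trans (h.left_le_right.trans hdp)
  have hleft : height ((S t).indicator x) c' - height ((S t).indicator x) p =
      height x c' - height x p :=
    height_indicator_sub_of_forall_mem hpc fun q hq =>
      (h'.mem_left_iff q ⟨hap.trans hq.1, hq.2.le⟩).2 ha
  calc height ((S s).indicator x) b = height ((S s).indicator x) p :=
        height_indicator_eq_of_forall_notMem hpb fun q hq hqS =>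
          hb' ((h.mem_right_iff q ⟨hdp.trans hq.1, hq.2.le⟩).1 hqS)
    _ ≤ height ((S t).indicator x) p := hS.monotone_height p hst
    _ < height ((S t).indicator x) d' := by linarith
    _ = height ((S t).indicator x) b :=
        (height_indicator_eq_of_forall_notMem h'.right_le fun q hq hqS =>
          hb ((h'.mem_right_iff q ⟨hq.1, hq.2.le⟩).1 hqS)).symm

variable {ι : Type*} [LinearOrder ι] {x : ℕ → ℤ} {S : ι → Set ℕ} (hS : IsErasure x S)
  {n a b : ℕ} {p c d : ℕ → ℕ} {T : ℕ → ι}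

include hS in
theorem le_succ_of_splitsWithin (hsplit : ∀ i < n, SplitsWithin (S (T i)) a b (c i) (d i))
    (hsep : ∀ i k, i < k → k < n → d i ≤ c k) (hT : T 0 ≤ T 1) {i : ℕ} (hi : i + 2 < n) :
    T (i + 1) ≤ T (i + 2) := by
  have hsep' (k : ℕ) : k + 1 < n → d 0 ≤ c (k + 1) := hsep 0 (k + 1) k.succ_pos
  have hsplit₀ := hsplit 0 (by omega)
  have hb : b ∉ S (T 0) := hsplit₀.right_notMem_of_subset (hsplit 1 (by omega))
    (hsep' 0 (by omega)) (hS.monotone hT)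
  have hT₀ : T 0 ≤ T (i + 2) := by
    by_contra! h
    exact hb (hsplit₀.right_mem_of_subset (hsplit _ hi) (hsep' _ hi) (hS.monotone h.le))
  have ha : a ∈ S (T (i + 2)) :=
    hsplit₀.left_mem_of_subset (hsplit _ hi) (hsep' _ hi) (hS.monotone hT₀)
  by_contra! h
  exact (hsplit (i + 1) (by omega)).left_notMem_of_subset (hsplit _ hi)
    (hsep _ _ (by omega) hi) (hS.monotone h.le) ha

include hS in
theorem natCast_le_height_of_splitsWithin_of_le
    (hsplit : ∀ i < n + 3, SplitsWithin (S (T i)) a b (c i) (d i))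
    (hdp : ∀ i k, i < k → k < n + 3 → d i ≤ p k) (hpc : ∀ i < n + 3, p i ≤ c i)
    (hclimb : ∀ i < n + 3, height ((S (T i)).indicator x) (c i) -
      height ((S (T i)).indicator x) (d i) < height x (c i) - height x (p i))
    (hT : T 0 ≤ T 1) : (n : ℤ) ≤ height x b := by
  have hdc : ∀ i k, i < k → k < n + 3 → d i ≤ c k := fun i k hik hk =>
    (hdp i k hik hk).trans (hpc k hk)
  have hmono {i : ℕ} (hi : i + 2 < n + 3) : T (i + 1) ≤ T (i + 2) :=
    hS.le_succ_of_splitsWithin hsplit hdc hT hi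
  have hright (i : ℕ) (hi : i + 2 < n + 3) : b ∉ S (T (i + 1)) :=
    (hsplit _ (by omega)).right_notMem_of_subset (hsplit _ hi) (hdc _ _ (by omega) hi)
      (hS.monotone (hmono hi))
  have hgrow : ∀ i ≤ n, (i : ℤ) ≤ height ((S (T (i + 1))).indicator x) b := by
    intro i hi
    induction i with
    | zero => exact_mod_cast hS.height_nonneg _ _
    | succ i ih =>
      have hlt := hS.height_lt_of_splitsWithin (hmono (by omega)) (hsplit (i + 1) (by omega))
        (hsplit (i + 2) (by omega)) (hdp _ _ (by omega) (by omega)) (hpc _ (by omega))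
        (hright (i + 1) (by omega)) (hclimb _ (by omega))
      have := ih (by omega)
      push_cast
      linarith
  exact (hgrow n le_rfl).trans (hS.height_le _ b)

include hS in
theorem natCast_le_height_of_splitsWithin
    (hsplit : ∀ i < n + 3, SplitsWithin (S (T i)) a b (c i) (d i))
    (hdp : ∀ i k, i < k → k < n + 3 → d i ≤ p k) (hpc : ∀ i < n + 3, p i ≤ c i)
    (hlevel : ∀ i < n + 3, height x (d i) = height x (c i))
    (hclimb : ∀ i < n + 3, |height ((S (T i)).indicator x) (d i) -
      height ((S (T i)).indicator x) (c i)| < height x (c i) - height x (p i)) :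
    (n : ℤ) ≤ height x b := by
  rcases le_total (T 0) (T 1) with hT | hT
  · refine hS.natCast_le_height_of_splitsWithin_of_le hsplit hdp hpc (fun i hi => ?_) hT
    linarith [(abs_lt.1 (hclimb i hi)).1]
  · refine hS.dual.natCast_le_height_of_splitsWithin_of_le (T := fun i => OrderDual.toDual (T i))
      (fun i hi => (hsplit i hi).compl) hdp hpc (fun i hi => ?_) hT
    simp only [height_indicator_compl, OrderDual.ofDual_toDual]
    linarith [(abs_lt.1 (hclimb i hi)).2, hlevel i hi]

end IsErasure

end Sweep

section Word

/-- The increments of the height of a word: `1` at an opening bracket, `-1` at a closing bracket,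
and `0` past the end of the word. -/
def walk (l : List DyckStep) (i : ℕ) : ℤ :=
  match l[i]? with
  | some DyckStep.U => 1
  | some DyckStep.D => -1
  | none => 0

theorem lt_length_of_walk_ne_zero {l : List DyckStep} {i : ℕ} (h : walk l i ≠ 0) :
    i < l.length := by
  contrapose! h
  rw [walk, List.getElem?_eq_none h]

theorem height_walk (l : List DyckStep) (n : ℕ) :
    height (walk l) n = (l.take n).count DyckStep.U - (l.take n).count DyckStep.D := by
  induction n with
  | zero => simp [height]
  | succ n ih =>
    have hstep : walk l n = l[n]?.toList.count DyckStep.U - l[n]?.toList.count DyckStep.D := by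
      rw [walk]
      rcases l[n]? with _ | _ | _ <;> rfl
    rw [height_succ, ih, hstep, List.take_add_one, List.count_append, List.count_append]
    push_cast
    ring

theorem height_walk_dyckWord_length (w : DyckWord) :
    height (walk w.toList) w.toList.length = 0 := by
  rw [height_walk, List.take_length, w.count_U_eq_count_D, sub_self]

theorem length_Z_succ (m : ℕ) : (Z (m + 1)).toList.length = 2 * (Z m).toList.length + 2 := by
  simp only [Z_succ, List.length_append, List.length_singleton]
  ring

theorem length_Z_add_two (m : ℕ) : (Z m).toList.length + 2 = 2 ^ (m + 1) := by
  induction m with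
  | zero => rfl
  | succ m ih => rw [length_Z_succ, pow_succ, ← ih]; ring

/-- The word `u` is the part of `l` that starts at position `a`. -/
def OccursAt (u l : List DyckStep) (a : ℕ) : Prop := ∀ i < u.length, l[a + i]? = u[i]?

namespace OccursAt

variable {u v l : List DyckStep} {w : DyckWord} {a m : ℕ}

theorem self (l : List DyckStep) : OccursAt l l 0 := fun i _ => by rw [zero_add]

theorem left_of_append (h : OccursAt (u ++ v) l a) : OccursAt u l a := fun i hi => by
  rw [h i (by grind), List.getElem?_append_left hi]

theorem right_of_append (h : OccursAt (u ++ v) l a) : OccursAt v l (a + u.length) :=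
  fun i hi => by
    rw [add_assoc, h _ (by grind), List.getElem?_append_right (by omega), Nat.add_sub_cancel_left]

theorem height_add (h : OccursAt u l a) {i : ℕ} (hi : i ≤ u.length) :
    height (walk l) (a + i) = height (walk l) a + height (walk u) i := by
  rw [height, Finset.sum_range_add]
  congr 1
  refine Finset.sum_congr rfl fun j hj => ?_
  rw [walk, walk, h j (by grind)]

theorem height_add_length (h : OccursAt w.toList l a) :
    height (walk l) (a + w.toList.length) = height (walk l) a := by
  rw [h.height_add le_rfl, height_walk_dyckWord_length, add_zero]

theorem left_subtree (h : OccursAt (Z (m + 1)).toList l a) : OccursAt (Z m).toList l (a + 1) :=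
  h.left_of_append.right_of_append.left_of_append

theorem right_subtree (h : OccursAt (Z (m + 1)).toList l a) :
    OccursAt (Z m).toList l (a + 1 + (Z m).toList.length) :=
  h.left_of_append.right_of_append.right_of_append

theorem height_left_subtree (h : OccursAt (Z (m + 1)).toList l a) :
    height (walk l) (a + 1) = height (walk l) a + 1 := by
  rw [h.height_add (by simp [Z_succ])]
  rfl

theorem height_right_subtree (h : OccursAt (Z (m + 1)).toList l a) :
    height (walk l) (a + 1 + (Z m).toList.length) = height (walk l) a + 1 := by
  rw [h.left_subtree.height_add_length, h.height_left_subtree]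

theorem height_mem_Icc (h : OccursAt (Z m).toList l a) :
    ∀ q ∈ Set.Icc a (a + (Z m).toList.length),
      height (walk l) q ∈ Set.Icc (height (walk l) a) (height (walk l) a + m) := by
  induction m generalizing a with
  | zero =>
    intro q hq
    obtain rfl : a = q := le_antisymm hq.1 hq.2
    simp
  | succ m ih =>
    rintro q ⟨haq, hqb⟩
    rw [length_Z_succ] at hqb
    have hleft := ih h.left_subtree q
    have hright := ih h.right_subtree q
    rw [h.height_left_subtree] at hleft
    rw [h.height_right_subtree] at hright
    push_cast
    rcases haq.eq_or_lt with rfl | haq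
    · constructor <;> linarith
    rcases hqb.eq_or_lt with rfl | hqb
    · rw [← length_Z_succ, h.height_add_length]
      constructor <;> linarith
    rcases le_total q (a + 1 + (Z m).toList.length) with hq | hq
    · obtain ⟨h₁, h₂⟩ := hleft ⟨haq, hq⟩
      constructor <;> linarith
    · obtain ⟨h₁, h₂⟩ := hright ⟨hq, by omega⟩
      constructor <;> linarith

theorem leftmost_subtree (s : ℕ) (h : OccursAt (Z (s + m)).toList l a) :
    OccursAt (Z m).toList l (a + s) ∧ height (walk l) (a + s) = height (walk l) a + s ∧
      s + (Z m).toList.length ≤ (Z (s + m)).toList.length := by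
  induction s generalizing a with
  | zero => simp_all
  | succ s ih =>
    rw [Nat.add_right_comm s 1 m] at h ⊢
    obtain ⟨hocc, hheight, hlen⟩ := ih h.left_subtree
    rw [h.height_left_subtree] at hheight
    rw [add_assoc, add_comm 1 s] at hocc hheight
    refine ⟨hocc, ?_, ?_⟩
    · rw [hheight]
      push_cast
      ring
    · rw [length_Z_succ]
      omega

theorem exists_disjoint_subtrees (s : ℕ) (h : OccursAt (Z (s + m)).toList l a) :
    ∃ g : ℕ → ℕ, (∀ i < 2 ^ s, OccursAt (Z m).toList l (g i) ∧ a ≤ g i ∧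
        g i + (Z m).toList.length ≤ a + (Z (s + m)).toList.length) ∧
      ∀ i k, i < k → k < 2 ^ s → g i + (Z m).toList.length ≤ g k := by
  induction s generalizing a with
  | zero => exact ⟨fun _ => a, by simp_all, by omega⟩
  | succ s ih =>
    rw [Nat.add_right_comm s 1 m] at h ⊢
    obtain ⟨g₁, hg₁, hsep₁⟩ := ih h.left_subtree
    obtain ⟨g₂, hg₂, hsep₂⟩ := ih h.right_subtree
    rw [length_Z_succ]
    refine ⟨fun i => if i < 2 ^ s then g₁ i else g₂ (i - 2 ^ s), fun i hi => ?_,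
      fun i k hik hk => ?_⟩
    · by_cases his : i < 2 ^ s
      · simp only [his, if_true]
        obtain ⟨hocc, hle, hge⟩ := hg₁ i his
        exact ⟨hocc, by omega, by omega⟩
      · simp only [his, if_false]
        obtain ⟨hocc, hle, hge⟩ := hg₂ (i - 2 ^ s) (by omega)
        exact ⟨hocc, by omega, by omega⟩
    · by_cases hks : k < 2 ^ s
      · simp only [hik.trans hks, hks, if_true]
        exact hsep₁ i k hik hks
      by_cases his : i < 2 ^ s
      · simp only [his, hks, if_true, if_false]
        exact (hg₁ i his).2.2.trans (hg₂ (k - 2 ^ s) (by omega)).2.1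
      · simp only [his, hks, if_false]
        exact hsep₂ _ _ (by omega) (by omega)

end OccursAt

end Word

section Recursion

variable {ι : Type*} [LinearOrder ι] {l : List DyckStep} {S : ι → Set ℕ} {K M m j a : ℕ}

theorem abs_height_indicator_sub_le_of_occursAt {S : Set ℕ} (hocc : OccursAt (Z m).toList l a)
    (hK : (switches S a (a + (Z m).toList.length)).card ≤ K) :
    |height (S.indicator (walk l)) (a + (Z m).toList.length) -
      height (S.indicator (walk l)) a| ≤ (K + 1) * m :=
  (abs_height_indicator_sub_le (Nat.le_add_right ..) hocc.height_mem_Icc).trans (by gcongr)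

theorem IsErasure.exists_succ_lt_card_switches (hS : IsErasure (walk l) S)
    (hK : ∀ t a b, (switches (S t) a b).card ≤ K)
    (hm : ∀ q, height (walk l) q + 4 ≤ 2 ^ m)
    (ih : ∀ a, OccursAt (Z m).toList l a →
      ∃ t, j < (switches (S t) a (a + (Z m).toList.length)).card)
    (hocc : OccursAt (Z ((K + 4) * m)).toList l a) :
    ∃ t, j + 1 < (switches (S t) a (a + (Z ((K + 4) * m)).toList.length)).card := by
  by_contra! hmax
  rw [show (K + 4) * m = m + ((K + 2) * m + m) by ring] at hocc hmax
  set b := a + (Z (m + ((K + 2) * m + m))).toList.length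
  have hpow : 4 ≤ 2 ^ m := by exact_mod_cast (zero_add (4 : ℤ)).symm.trans_le (hm 0)
  have hm₀ : 0 < m := Nat.pos_of_ne_zero fun h => by norm_num [h] at hpow
  obtain ⟨n, hn⟩ : ∃ n, 2 ^ m = n + 3 := Nat.exists_eq_add_of_le' (by omega)
  obtain ⟨p, hp, hsep⟩ := hocc.exists_disjoint_subtrees
  rw [hn] at hp hsep
  have hdeep (i : ℕ) (hi : i < n + 3) := (hp i hi).1.leftmost_subtree
  have : Nonempty ι := (ih _ (hdeep 0 (by omega)).1).nonempty
  choose! T hT using fun i hi => ih _ (hdeep i hi).1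
  have hsplit : ∀ i < n + 3, SplitsWithin (S (T i)) a b (p i + (K + 2) * m)
      (p i + (K + 2) * m + (Z m).toList.length) := fun i hi => by
    have := hp i hi
    have := hdeep i hi
    exact splitsWithin_of_card_switches_le (by omega) (by omega)
      (Finset.card_pos.1 ((Nat.zero_le j).trans_lt (hT i hi))) ((hmax _).trans (hT i hi))
  have hclimb : ∀ i < n + 3, (K + 1) * m < height (walk l) (p i + (K + 2) * m) -
      height (walk l) (p i) := fun i hi => by
    rw [(hdeep i hi).2.1]
    push_cast
    linarith
  have hright : (n : ℤ) ≤ height (walk l) b :=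
    hS.natCast_le_height_of_splitsWithin hsplit
      (fun i k hik hk => by
        have := hsep i k hik hk
        have := hdeep i (by omega)
        omega)
      (fun i _ => Nat.le_add_right ..)
      (fun i hi => (hdeep i hi).1.height_add_length)
      (fun i hi => (abs_height_indicator_sub_le_of_occursAt (hdeep i hi).1 (hK _ _ _)).trans_lt
        (hclimb i hi))
  have hb' := hm b
  rw [show (2 ^ m : ℤ) = n + 3 by exact_mod_cast hn] at hb'
  linarith

theorem IsErasure.exists_lt_card_switches (hS : IsErasure (walk l) S)
    (hK : ∀ t a b, (switches (S t) a b).card ≤ K)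
    (hM : ∀ q, height (walk l) q + 4 ≤ 2 ^ M)
    (hswitch : ∀ a, OccursAt (Z M).toList l a →
      ∃ t, (switches (S t) a (a + (Z M).toList.length)).Nonempty) (j : ℕ)
    (hocc : OccursAt (Z ((K + 4) ^ j * M)).toList l a) :
    ∃ t, j < (switches (S t) a (a + (Z ((K + 4) ^ j * M)).toList.length)).card := by
  induction j generalizing a with
  | zero =>
    rw [pow_zero, one_mul] at hocc ⊢
    exact (hswitch a hocc).imp fun _ => Finset.card_pos.2
  | succ j ih =>
    rw [pow_succ', mul_assoc] at hocc ⊢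
    refine hS.exists_succ_lt_card_switches hK (fun q => (hM q).trans ?_) (fun a => ih) hocc
    exact pow_le_pow_right₀ one_le_two (Nat.le_mul_of_pos_left M (by positivity))

end Recursion

section IntervalWidth

theorem exists_eq_iUnion_Icc (S : Finset ℤ) :
    ∃ a b : Fin (intervalWidth S) → ℤ, (S : Set ℤ) = ⋃ i, Set.Icc (a i) (b i) := by
  have hne : {k : ℕ | ∃ a b : Fin k → ℤ, (S : Set ℤ) = ⋃ i, Set.Icc (a i) (b i)}.Nonempty := by
    refine ⟨S.card, fun i => S.equivFin.symm i, fun i => S.equivFin.symm i, ?_⟩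
    ext z
    simp only [Set.Icc_self, Set.mem_iUnion, Set.mem_singleton_iff]
    refine ⟨fun hz => ⟨S.equivFin ⟨z, hz⟩, by simp⟩, ?_⟩
    rintro ⟨i, rfl⟩
    exact (S.equivFin.symm i).2
  exact Nat.sInf_mem hne

theorem card_switches_le (S : Finset ℤ) (a b : ℕ) :
    (switches {q : ℕ | (q : ℤ) ∈ S} a b).card ≤ 2 * intervalWidth S := by
  obtain ⟨l, r, hS⟩ := exists_eq_iUnion_Icc S
  have hmem (z : ℤ) : z ∈ S ↔ ∃ i, l i ≤ z ∧ z ≤ r i := by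
    rw [← Finset.mem_coe, hS]
    simp only [Set.mem_iUnion, Set.mem_Icc]
  have hends : switches {q : ℕ | (q : ℤ) ∈ S} a b ⊆
      Finset.univ.image (fun i => (r i).toNat) ∪ Finset.univ.image fun i => (l i - 1).toNat := by
    intro p hp
    have hp := (mem_switches.1 hp).2
    simp only [Set.mem_ofPred_eq, hmem] at hp
    simp only [Finset.mem_union, Finset.mem_image, Finset.mem_univ, true_and]
    push_cast at hp
    by_cases hpS : ∃ i, l i ≤ (p : ℤ) ∧ p ≤ r i
    · obtain ⟨i, hi⟩ := hpS
      refine Or.inl ⟨i, ?_⟩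
      by_contra hne
      exact hp (iff_of_true ⟨i, hi⟩ ⟨i, by omega, by omega⟩)
    · obtain ⟨i, hi⟩ : ∃ i, l i ≤ (p : ℤ) + 1 ∧ (p : ℤ) + 1 ≤ r i :=
        by_contra fun h => hp (iff_of_false hpS h)
      refine Or.inr ⟨i, ?_⟩
      by_contra hne
      exact hpS ⟨i, by omega, by omega⟩
  calc (switches {q : ℕ | (q : ℤ) ∈ S} a b).card
      ≤ _ := Finset.card_le_card hends
    _ ≤ (Finset.univ.image fun i => (r i).toNat).card +
          (Finset.univ.image fun i => (l i - 1).toNat).card := Finset.card_union_le _ _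
    _ ≤ intervalWidth S + intervalWidth S :=
        add_le_add (Finset.card_image_le.trans_eq (Finset.card_fin _))
          (Finset.card_image_le.trans_eq (Finset.card_fin _))
    _ = 2 * intervalWidth S := (two_mul _).symm

end IntervalWidth

namespace Repairing

variable {w : DyckWord} (p : Repairing w)

/-- The positions erased by the first `t` pairs of a re-pairing, as a set of natural numbers, so
that walks can be restricted to it. -/
def erasedSet (t : ℕ) : Set ℕ := {q | (q : ℤ) ∈ p.erased t}

theorem mem_erasedSet {t q : ℕ} :
    q ∈ p.erasedSet t ↔
      ∃ i : Fin (w.toList.length / 2), (i : ℕ) < t ∧ (q = p.left i ∨ q = p.right i) := by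
  simp [erasedSet, erased]

theorem lt_length_of_mem_erasedSet {t q : ℕ} (hq : q ∈ p.erasedSet t) : q < w.toList.length := by
  obtain ⟨i, -, rfl | rfl⟩ := p.mem_erasedSet.1 hq <;> exact Fin.is_lt _

theorem erasedSet_zero : p.erasedSet 0 = ∅ := by
  ext q
  simp [mem_erasedSet]

theorem monotone_erasedSet : Monotone p.erasedSet := fun s t hst q hq => by
  rw [mem_erasedSet] at hq ⊢
  exact hq.imp fun i hi => ⟨hi.1.trans_le hst, hi.2⟩

theorem mem_erasedSet_iff_lt {t : ℕ} {b : Fin w.toList.length} {i : Fin (w.toList.length / 2)}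
    (hb : b = p.left i ∨ b = p.right i) : (b : ℕ) ∈ p.erasedSet t ↔ (i : ℕ) < t := by
  rw [mem_erasedSet]
  refine ⟨fun ⟨k, hk, hbk⟩ => ?_, fun hi => ⟨i, hi, by simpa only [Fin.ext_iff] using hb⟩⟩
  rwa [(p.exactly_one b).unique hb (by simpa only [Fin.ext_iff] using hbk)]

theorem erasedSet_succ (i : Fin (w.toList.length / 2)) :
    p.erasedSet (i + 1) = p.erasedSet i ∪ {↑(p.left i), ↑(p.right i)} := by
  ext q
  simp only [Set.mem_union, mem_erasedSet, Set.mem_insert_iff, Set.mem_singleton_iff,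
    Nat.lt_succ_iff_lt_or_eq, or_and_right, exists_or, Fin.val_inj, exists_eq_left]

theorem mem_erasedSet_of_le {t q : ℕ} (ht : w.toList.length / 2 ≤ t) (hq : q < w.toList.length) :
    q ∈ p.erasedSet t := by
  obtain ⟨i, hi, -⟩ := p.exactly_one ⟨q, hq⟩
  exact (p.mem_erasedSet_iff_lt hi).2 (i.is_lt.trans_le ht)

theorem erasedSet_eq_of_le {t : ℕ} (ht : w.toList.length / 2 ≤ t) :
    p.erasedSet t = Set.Iio w.toList.length :=
  Set.ext fun _ => ⟨p.lt_length_of_mem_erasedSet, p.mem_erasedSet_of_le ht⟩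

theorem card_switches_erasedSet_le (t a b : ℕ) :
    (switches (p.erasedSet t) a b).card ≤ 2 * p.width := by
  obtain ⟨s, hs, hst⟩ : ∃ s ≤ w.toList.length / 2, p.erasedSet t = p.erasedSet s := by
    rcases le_total t (w.toList.length / 2) with ht | ht
    · exact ⟨t, ht, rfl⟩
    · exact ⟨_, le_rfl, by rw [p.erasedSet_eq_of_le ht, p.erasedSet_eq_of_le le_rfl]⟩
  rw [hst]
  refine (card_switches_le (p.erased s) a b).trans (Nat.mul_le_mul_left 2 ?_)
  exact Finset.le_sup (f := fun t => intervalWidth (p.erased t))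
    (Finset.mem_range.2 (Nat.lt_succ_of_le hs))

theorem exists_nonempty_switches {a : ℕ} (ha : a + 2 < w.toList.length) :
    ∃ t, (switches (p.erasedSet t) a (a + 2)).Nonempty := by
  obtain ⟨i, hi, -⟩ := p.exactly_one ⟨a, by omega⟩
  obtain ⟨j, hj, -⟩ := p.exactly_one ⟨a + 1, by omega⟩
  obtain ⟨k, hk, -⟩ := p.exactly_one ⟨a + 2, ha⟩
  have hmem_i (t : ℕ) : a ∈ p.erasedSet t ↔ (i : ℕ) < t := p.mem_erasedSet_iff_lt hi
  have hmem_j (t : ℕ) : a + 1 ∈ p.erasedSet t ↔ (j : ℕ) < t := p.mem_erasedSet_iff_lt hj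
  have hmem_k (t : ℕ) : a + 2 ∈ p.erasedSet t ↔ (k : ℕ) < t := p.mem_erasedSet_iff_lt hk
  by_cases hij : i = j
  · refine ⟨max j k, a + 1, mem_switches.2 ⟨by omega, ?_⟩⟩
    rw [hmem_j, hmem_k]
    grind
  · refine ⟨max i j, a, mem_switches.2 ⟨by omega, ?_⟩⟩
    rw [hmem_i, hmem_j]
    grind

theorem height_indicator_erasedSet_succ (i : Fin (w.toList.length / 2)) (x : ℕ → ℤ) (n : ℕ) :
    height ((p.erasedSet (i + 1)).indicator x) n = height ((p.erasedSet i).indicator x) n +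
      height (({↑(p.left i), ↑(p.right i)} : Set ℕ).indicator x) n := by
  have hdisj : Disjoint (p.erasedSet i) {↑(p.left i), ↑(p.right i)} := by
    simp only [Set.disjoint_insert_right, Set.disjoint_singleton_right,
      p.mem_erasedSet_iff_lt (Or.inl rfl), p.mem_erasedSet_iff_lt (Or.inr rfl), lt_irrefl,
      not_false_eq_true, and_self]
  rw [erasedSet_succ, height_indicator_union x hdisj]

theorem height_indicator_pair_nonneg (i : Fin (w.toList.length / 2)) (n : ℕ) :
    0 ≤ height (({↑(p.left i), ↑(p.right i)} : Set ℕ).indicator (walk w.toList)) n := by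
  have hlt : (p.left i : ℕ) < p.right i := p.left_lt_right i
  have hU : walk w.toList (p.left i) = 1 := by
    rw [walk, List.getElem?_eq_getElem (p.left i).is_lt, ← List.get_eq_getElem, p.left_open]
  have hD : walk w.toList (p.right i) = -1 := by
    rw [walk, List.getElem?_eq_getElem (p.right i).is_lt, ← List.get_eq_getElem, p.right_close]
  rw [Set.insert_eq, height_indicator_union _ (Set.disjoint_singleton.2 hlt.ne),
    height_indicator_singleton, height_indicator_singleton, hU, hD]
  split_ifs <;> omega

theorem monotone_height (n : ℕ) :
    Monotone fun t => height ((p.erasedSet t).indicator (walk w.toList)) n := by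
  refine monotone_nat_of_le_succ fun t => ?_
  rcases lt_or_ge t (w.toList.length / 2) with ht | ht
  · rw [p.height_indicator_erasedSet_succ ⟨t, ht⟩]
    exact le_add_of_nonneg_right (p.height_indicator_pair_nonneg ⟨t, ht⟩ n)
  · rw [p.erasedSet_eq_of_le ht, p.erasedSet_eq_of_le (ht.trans t.le_succ)]

theorem isErasure : IsErasure (walk w.toList) p.erasedSet where
  monotone := p.monotone_erasedSet
  monotone_height := p.monotone_height
  height_nonneg t n := by
    refine le_of_eq_of_le ?_ (p.monotone_height n t.zero_le)
    simp [erasedSet_zero, height]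
  height_le t n := by
    refine (p.monotone_height n (le_max_left t (w.toList.length / 2))).trans_eq ?_
    beta_reduce
    have hsupp : Function.support (walk w.toList) ⊆ Set.Iio w.toList.length := fun _ =>
      lt_length_of_walk_ne_zero
    rw [p.erasedSet_eq_of_le (le_max_right ..), Set.indicator_eq_self.2 hsupp]

end Repairing

section Existence

variable {α : Type*} [DecidableEq α] {l : List α} {c : α} {k q : ℕ}

/-- The position of the `k`-th letter `c` of the word `l`, counted from `0`. This is `0` if there is
no such letter. -/
noncomputable def letterPos (l : List α) (c : α) (k : ℕ) : ℕ := Nat.nth (fun q => l[q]? = some c) k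

theorem count_getElem?_eq (l : List α) (c : α) (n : ℕ) :
    Nat.count (fun q => l[q]? = some c) n = (l.take n).count c := by
  induction n with
  | zero => simp
  | succ n ih =>
    rw [Nat.count_succ, ih, List.take_add_one, List.count_append]
    rcases l[n]? with _ | d
    · simp
    · simp [List.count_singleton]

theorem lt_card_of_lt_count (hk : k < l.count c) (hf : {q : ℕ | l[q]? = some c}.Finite) :
    k < hf.toFinset.card := by
  refine hk.trans_le ?_
  have hcount := Nat.count_le_card hf l.length
  rwa [count_getElem?_eq, List.take_length] at hcount

theorem letterPos_lt_of_lt_count {n : ℕ} (hk : k < (l.take n).count c) : letterPos l c k < n :=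
  Nat.nth_lt_of_lt_count (by rwa [count_getElem?_eq])

theorem getElem?_letterPos (hk : k < l.count c) : l[letterPos l c k]? = some c :=
  Nat.nth_mem (p := fun q => l[q]? = some c) k (lt_card_of_lt_count hk)

theorem count_take_letterPos (hk : k < l.count c) : (l.take (letterPos l c k)).count c = k := by
  rw [← count_getElem?_eq]
  exact Nat.count_nth (lt_card_of_lt_count hk)

theorem letterPos_count_take (hq : l[q]? = some c) : letterPos l c ((l.take q).count c) = q := by
  rw [← count_getElem?_eq]
  exact Nat.nth_count hq

theorem count_take_succ (hq : l[q]? = some c) :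
    (l.take (q + 1)).count c = (l.take q).count c + 1 := by
  simp [List.take_add_one, hq]

theorem count_take_lt_count (hq : l[q]? = some c) : (l.take q).count c < l.count c := by
  rw [Nat.lt_iff_add_one_le, ← count_take_succ hq]
  exact (List.take_sublist _ _).count_le c

theorem count_eq_length_div_two (w : DyckWord) (c : DyckStep) :
    w.toList.count c = w.toList.length / 2 := by
  have hlen := w.two_mul_semilength_eq_length
  cases c
  · rw [← hlen, Nat.mul_div_cancel_left _ two_pos]
    rfl
  · rw [← hlen, Nat.mul_div_cancel_left _ two_pos, w.semilength_eq_count_D]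

theorem letterPos_open_lt_letterPos_close {w : DyckWord} (hk : k < w.toList.length / 2) :
    letterPos w.toList DyckStep.U k < letterPos w.toList DyckStep.D k := by
  have hU := getElem?_letterPos (hk.trans_eq (count_eq_length_div_two w DyckStep.U).symm)
  have hkD := hk.trans_eq (count_eq_length_div_two w DyckStep.D).symm
  have hD := getElem?_letterPos hkD
  have hle : letterPos w.toList DyckStep.U k < letterPos w.toList DyckStep.D k + 1 := by
    refine letterPos_lt_of_lt_count (lt_of_lt_of_le ?_ (w.count_D_le_count_U _))
    rw [count_take_succ hD, count_take_letterPos hkD]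
    exact k.lt_succ_self
  refine lt_of_le_of_ne (Nat.lt_succ_iff.1 hle) fun heq => ?_
  rw [heq, hD] at hU
  exact absurd hU (by decide)

theorem existsUnique_letterPos {w : DyckWord} (hq : q < w.toList.length) :
    ∃! k : Fin (w.toList.length / 2),
      q = letterPos w.toList DyckStep.U k ∨ q = letterPos w.toList DyckStep.D k := by
  obtain ⟨c, hc⟩ : ∃ c, w.toList[q]? = some c := ⟨_, List.getElem?_eq_getElem hq⟩
  have hcount (d : DyckStep) (k : Fin (w.toList.length / 2)) (hk : q = letterPos w.toList d k) :
      (w.toList.take q).count c = k := by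
    have hkd := k.is_lt.trans_eq (count_eq_length_div_two w d).symm
    have hd := getElem?_letterPos hkd
    rw [← hk, hc, Option.some_inj] at hd
    rw [hd, hk, count_take_letterPos hkd]
  refine ⟨⟨_, (count_take_lt_count hc).trans_eq (count_eq_length_div_two w c)⟩, ?_,
    fun k hk => Fin.ext (hk.elim (hcount _ k) (hcount _ k)).symm⟩
  have hpos := (letterPos_count_take hc).symm
  cases c
  · exact Or.inl hpos
  · exact Or.inr hpos

theorem nonempty_repairing (w : DyckWord) : Nonempty (Repairing w) := by
  have hcount {c : DyckStep} (k : Fin (w.toList.length / 2)) : (k : ℕ) < w.toList.count c :=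
    k.is_lt.trans_eq (count_eq_length_div_two w c).symm
  have hlt {c : DyckStep} (k : Fin (w.toList.length / 2)) :
      letterPos w.toList c k < w.toList.length :=
    letterPos_lt_of_lt_count (by rw [List.take_length]; exact hcount k)
  refine ⟨⟨fun k => ⟨_, hlt (c := DyckStep.U) k⟩, fun k => ⟨_, hlt (c := DyckStep.D) k⟩,
    fun k => ?_, fun k => ?_, fun k => letterPos_open_lt_letterPos_close k.is_lt, fun b => ?_⟩⟩
  · exact (List.getElem_eq_iff _).2 (getElem?_letterPos (hcount k))
  · exact (List.getElem_eq_iff _).2 (getElem?_letterPos (hcount k))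
  · simpa only [Fin.ext_iff] using existsUnique_letterPos b.is_lt

theorem exists_width_eq (w : DyckWord) : ∃ p : Repairing w, p.width = width w :=
  have := nonempty_repairing w
  Nat.sInf_mem (Set.range_nonempty _)

end Existence

section LowerBound

theorem OccursAt.lt_length {u l : List DyckStep} {a i : ℕ} (h : OccursAt u l a)
    (hi : i < u.length) : a + i < l.length := by
  by_contra! hle
  have := h i hi
  rw [List.getElem?_eq_none hle, List.getElem?_eq_getElem hi] at this
  exact Option.some_ne_none _ this.symm

theorem height_walk_Z_le (n q : ℕ) : height (walk (Z n).toList) q ≤ n := by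
  have hmem := (OccursAt.self (Z n).toList).height_mem_Icc
  rw [zero_add, show height (walk (Z n).toList) 0 = 0 from rfl, zero_add] at hmem
  rcases le_total q (Z n).toList.length with hq | hq
  · exact (hmem q ⟨q.zero_le, hq⟩).2
  · rw [height_walk, List.take_of_length_le hq, (Z n).count_U_eq_count_D, sub_self]
    exact n.cast_nonneg

theorem lt_pow_two_mul_width_mul {n M : ℕ} (hM : n + 4 ≤ 2 ^ M) :
    n < (2 * width (Z n) + 4) ^ (2 * width (Z n)) * M := by
  obtain ⟨p, hp⟩ := exists_width_eq (Z n)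
  rw [← hp]
  by_contra! hn
  obtain ⟨s, hs⟩ := Nat.exists_eq_add_of_le' hn
  have hroot := OccursAt.self (Z n).toList
  nth_rw 1 [hs] at hroot
  have hM' (q : ℕ) : height (walk (Z n).toList) q + 4 ≤ 2 ^ M :=
    (add_le_add_left (height_walk_Z_le n q) 4).trans (by exact_mod_cast hM)
  have hswitch (a : ℕ) (hocc : OccursAt (Z M).toList (Z n).toList a) :
      ∃ t, (switches (p.erasedSet t) a (a + (Z M).toList.length)).Nonempty := by
    have hlen : 2 < (Z M).toList.length := by
      have := length_Z_add_two M
      have := pow_succ 2 M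
      omega
    exact (p.exists_nonempty_switches (hocc.lt_length hlen)).imp fun t ht =>
      ht.mono (switches_subset le_rfl (by omega))
  obtain ⟨t, ht⟩ := p.isErasure.exists_lt_card_switches p.card_switches_erasedSet_le hM' hswitch
    (2 * p.width) (hroot.leftmost_subtree).1
  exact ht.not_ge (p.card_switches_erasedSet_le t _ _)

theorem sq_add_four_le_two_pow {r : ℕ} (hr : 6 ≤ r) : (r + 1) ^ 2 + 4 ≤ 2 ^ r := by
  induction r, hr using Nat.le_induction with
  | base => norm_num
  | succ r hr ih =>
    rw [pow_succ 2 r]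
    nlinarith

theorem lt_pow_four_mul_width {n : ℕ} (hn : 36 ≤ n) :
    n < (2 * width (Z n) + 4) ^ (4 * width (Z n)) := by
  have hsqrt : 6 ≤ n.sqrt := Nat.le_sqrt'.2 hn
  have hlt := lt_pow_two_mul_width_mul
    ((add_le_add_left n.lt_succ_sqrt'.le 4).trans (sq_add_four_le_two_pow hsqrt))
  set X := (2 * width (Z n) + 4) ^ (2 * width (Z n)) with hX
  have hle : n.sqrt < X := by
    by_contra! h
    exact hlt.not_ge ((Nat.mul_le_mul_right _ h).trans n.sqrt_le)
  calc n < X * n.sqrt := hlt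
    _ ≤ X * X := Nat.mul_le_mul_left X hle.le
    _ = (2 * width (Z n) + 4) ^ (4 * width (Z n)) := by rw [hX, ← pow_add]; ring

theorem log_le_mul_width_mul_log {n : ℕ} (hn : 36 ≤ n) :
    Real.log n ≤ 4 * width (Z n) * Real.log (2 * width (Z n) + 4) := by
  have hlt : (n : ℝ) ≤ (2 * width (Z n) + 4) ^ (4 * width (Z n)) := by
    exact_mod_cast (lt_pow_four_mul_width hn).le
  have hlog := Real.log_le_log (by positivity) hlt
  rw [Real.log_pow] at hlog
  exact_mod_cast hlog

theorem div_log_le_of_le_mul_log {x y : ℝ} (hx : 4 ≤ x) (hy : 0 ≤ y)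
    (h : x ≤ 4 * y * Real.log (2 * y + 4)) : x / Real.log x ≤ 8 * y := by
  have hlog : 1 ≤ Real.log x := by
    rw [Real.le_log_iff_exp_le (by linarith)]
    linarith [Real.exp_one_lt_d9]
  rw [div_le_iff₀ (by linarith)]
  rcases le_total (2 * y + 4) (x ^ 2) with hsq | hsq
  · have hle := Real.log_le_log (by linarith) hsq
    rw [Real.log_pow] at hle
    push_cast at hle
    nlinarith
  · nlinarith

theorem tendsto_log_natCast_atTop : Tendsto (fun n : ℕ => Real.log n) atTop atTop :=
  Real.tendsto_log_atTop.comp tendsto_natCast_atTop_atTop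

theorem isBigO_log_div_log_log_width :
    (fun n : ℕ => Real.log n / Real.log (Real.log n))
      =O[atTop] fun n : ℕ => (width (Z n) : ℝ) := by
  refine IsBigO.of_bound 8 ?_
  filter_upwards [eventually_ge_atTop 36, tendsto_log_natCast_atTop.eventually_ge_atTop 4]
    with n hn hlogn
  have hnonneg : 0 ≤ Real.log (Real.log n) := Real.log_nonneg (by linarith)
  rw [Real.norm_of_nonneg (by positivity), Real.norm_of_nonneg (Nat.cast_nonneg _)]
  exact div_log_le_of_le_mul_log hlogn (Nat.cast_nonneg _) (log_le_mul_width_mul_log hn)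

end LowerBound

section LogLogLength

theorem tendsto_two_pow_succ : Tendsto (fun n : ℕ => (2 : ℝ) ^ (n + 1)) atTop atTop :=
  (tendsto_pow_atTop_atTop_of_one_lt one_lt_two).comp (tendsto_add_atTop_nat 1)

theorem tendsto_natCast_mul_log_two : Tendsto (fun n : ℕ => n * Real.log 2) atTop atTop :=
  tendsto_natCast_atTop_atTop.atTop_mul_const (Real.log_pos one_lt_two)

theorem isEquivalent_length_Z :
    (fun n : ℕ => ((Z n).toList.length : ℝ)) ~[atTop] fun n : ℕ => (2 : ℝ) ^ (n + 1) := by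
  have hlen : (fun n : ℕ => ((Z n).toList.length : ℝ)) =
      fun n : ℕ => (2 : ℝ) ^ (n + 1) + (-2) := by
    funext n
    rw [← sub_eq_add_neg, eq_sub_iff_add_eq]
    exact_mod_cast length_Z_add_two n
  rw [hlen]
  exact IsEquivalent.refl.add_const_of_norm_tendsto_atTop
    (tendsto_norm_atTop_atTop.comp tendsto_two_pow_succ)

theorem isEquivalent_log_length_Z :
    (fun n : ℕ => Real.log ((Z n).toList.length : ℝ)) ~[atTop]
      fun n : ℕ => n * Real.log 2 := by
  refine (isEquivalent_length_Z.log tendsto_two_pow_succ).trans ?_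
  have hlog : (fun n : ℕ => Real.log ((2 : ℝ) ^ (n + 1))) =
      fun n : ℕ => n * Real.log 2 + Real.log 2 := by
    funext n
    rw [Real.log_pow]
    push_cast
    ring
  rw [hlog]
  exact IsEquivalent.refl.add_const_of_norm_tendsto_atTop
    (tendsto_norm_atTop_atTop.comp tendsto_natCast_mul_log_two)

theorem isEquivalent_log_log_length_Z :
    (fun n : ℕ => Real.log (Real.log ((Z n).toList.length : ℝ)))
      ~[atTop] fun n : ℕ => Real.log n := by
  refine (isEquivalent_log_length_Z.log tendsto_natCast_mul_log_two).trans ?_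
  have hlog : (fun n : ℕ => Real.log (n * Real.log 2)) =ᶠ[atTop]
      fun n : ℕ => Real.log n + Real.log (Real.log 2) := by
    filter_upwards [eventually_ne_atTop 0] with n hn
    exact Real.log_mul (Nat.cast_ne_zero.2 hn) (Real.log_pos one_lt_two).ne'
  exact hlog.trans_isEquivalent (IsEquivalent.refl.add_const_of_norm_tendsto_atTop
    (tendsto_norm_atTop_atTop.comp tendsto_log_natCast_atTop))

theorem isTheta_log_div_log_log :
    (fun n : ℕ => Real.log n / Real.log (Real.log n))
      =Θ[atTop] fun n : ℕ => Real.log (Real.log ((Z n).toList.length : ℝ)) /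
        Real.log (Real.log (Real.log ((Z n).toList.length : ℝ))) :=
  (isEquivalent_log_log_length_Z.div
    (isEquivalent_log_log_length_Z.log tendsto_log_natCast_atTop)).isTheta_symm

end LogLogLength

end RePairing

theorem mainTheorem4 :
    ((fun n : ℕ => Real.log n / Real.log (Real.log n))
      =O[atTop] fun n : ℕ => (RePairing.width (RePairing.Z n) : ℝ)) ∧
    ((fun n : ℕ => Real.log (Real.log ((RePairing.Z n).toList.length : ℝ)) /
        Real.log (Real.log (Real.log ((RePairing.Z n).toList.length : ℝ))))
      =O[atTop] fun n : ℕ => (RePairing.width (RePairing.Z n) : ℝ)) ∧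
    ((fun n : ℕ => Real.log n / Real.log (Real.log n))
      =Θ[atTop] fun n : ℕ => Real.log (Real.log ((RePairing.Z n).toList.length : ℝ)) /
        Real.log (Real.log (Real.log ((RePairing.Z n).toList.length : ℝ)))) :=
  ⟨RePairing.isBigO_log_div_log_log_width,
    RePairing.isTheta_log_div_log_log.2.trans RePairing.isBigO_log_div_log_log_width,
    RePairing.isTheta_log_div_log_log⟩
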